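/- Let $G$ be a finite simple graph on $n$ vertices with vertex set $V(G)$, let $p(G,r)$ be the number of sets of $r$ pairwise vertex-disjoint edges of $G$ (so $p(G,0)=1$), and let $\mu(G,x)=\sum_{r=0}^{\lfloor n/2\rfloor}(-1)^r p(G,r)\,x^{n-2r}$ be the matching polynomial of $G$. For a real number $\theta$, let $\operatorname{mult}(\theta,G)$ be the multiplicity of $\theta$ as a root of $\mu(G,x)$ (equal to $0$ if $\theta$ is not a root), and for $X\subseteq V(G)$ let $G\setminus X$ be the graph obtained from $G$ by deleting the vertices in $X$ together with all edges that meet $X$. Call $X$ *$\theta$-extreme* in $G$ if $\operatorname{mult}(\theta,G\setminus X)=\operatorname{mult}(\theta,G)+|X|$, and, when $|X|>1$, call $X$ *$\theta$-nice* in $G$ if $\operatorname{mult}(\theta,G\setminus\{u,v\})=\operatorname{mult}(\theta,G)+2$ for all $u,v\in X$ with $u\neq v$. **Theorem.** For every finite simple graph $G$, every real number $\theta$ and every $X\subseteq V(G)$ with $|X|>1$, the set $X$ is $\theta$-extreme in $G$ if and only if $X$ is $\theta$-nice in $G$. -/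

import Mathlib

open Polynomial

namespace SimpleGraph

/-- A set `M` of edges of `G`, no two distinct members of which have a vertex in common. -/
def IsEdgeMatching {V : Type*} (G : SimpleGraph V) (M : Finset (Sym2 V)) : Prop :=
  (∀ e ∈ M, e ∈ G.edgeSet) ∧ ∀ e ∈ M, ∀ f ∈ M, e ≠ f → ∀ v, v ∈ e → v ∉ f

/-- The number `p(G, r)` of `r`-matchings of `G`. -/
noncomputable def numMatchings {V : Type*} [Finite V] (G : SimpleGraph V) (r : ℕ) : ℕ :=
  {M : Finset (Sym2 V) | G.IsEdgeMatching M ∧ M.card = r}.ncard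

/-- The matching polynomial `∑_{r = 0}^{⌊n/2⌋} (-1)^r p(G, r) x^(n - 2 r)`, where `n = |V(G)|`. -/
noncomputable def matchingPolynomial {V : Type*} [Finite V] (G : SimpleGraph V) : ℝ[X] :=
  ∑ r ∈ Finset.range (Nat.card V / 2 + 1),
    C ((-1 : ℝ) ^ r * (G.numMatchings r : ℝ)) * X ^ (Nat.card V - 2 * r)

/-- `mult(θ, G)`: the multiplicity of `θ` as a root of the matching polynomial of `G`
(zero if `θ` is not a root). -/
noncomputable def matchingMult {V : Type*} [Finite V] (θ : ℝ) (G : SimpleGraph V) : ℕ :=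
  G.matchingPolynomial.rootMultiplicity θ

/-- `G ∖ S`: delete the vertices in `S` and all edges that meet `S`. -/
abbrev removeVerts {V : Type*} (G : SimpleGraph V) (S : Set V) : SimpleGraph ↥Sᶜ :=
  G.induce Sᶜ

/-- `S` is a `θ`-extreme set in `G`. -/
def IsExtreme {V : Type*} [Finite V] (G : SimpleGraph V) (θ : ℝ) (S : Set V) : Prop :=
  matchingMult θ (G.removeVerts S) = matchingMult θ G + S.ncard

/-- `S` is `θ`-nice in `G`. -/
def IsNice {V : Type*} [Finite V] (G : SimpleGraph V) (θ : ℝ) (S : Set V) : Prop :=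
  1 < S.ncard ∧
    ∀ u ∈ S, ∀ v ∈ S, u ≠ v → matchingMult θ (G.removeVerts {u, v}) = matchingMult θ G + 2

end SimpleGraph

/-! Write f_S(z) for the multivariate matching polynomial of G ∖ S. By the Heilmann–Lieb argument it
has no zero when all variables lie in the open upper half plane (`matchingSum_ne_zero_and_im_le`).
At z = θ + iε with ε → 0⁺, |f_S| has exact order ε^mult(θ, G ∖ S) (`isTheta_matchingSum`), so
inequalities between multiplicities become norm estimates.

Deleting one vertex raises the multiplicity by at most 1 (`matchingMult_insert_le`), so every pair
in an extreme set is extreme. For the converse, the key case is three vertices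
(`add_three_le_matchingMult`). Shifting their variables by a common x turns f_S into a cubic in x
with no zero in the upper half plane. Its coefficients are sums of deletions of 0, 1, 2 and 3 of the
vertices, and stability lets the first three control the last. Hence nice pairs stay nice after
deleting a third vertex of the set, and induction on the set finishes
(`matchingMult_union_of_pairs`). -/

namespace SimpleGraph

/-! ### Multivariate matching polynomials and the vertex recurrence -/

section
variable {V : Type*} [Fintype V]

open Classical in
/-- The matchings of `G` that avoid the vertices in `S`. -/
noncomputable def matchingsAvoiding (G : SimpleGraph V) (S : Finset V) :
    Finset (Finset (Sym2 V)) :=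
  {M | G.IsEdgeMatching M ∧ ∀ e ∈ M, ∀ v ∈ e, v ∉ S}

open Classical in
/-- The vertices outside `S` that are not covered by `M`. -/
noncomputable def uncovered (S : Finset V) (M : Finset (Sym2 V)) : Finset V :=
  {v | v ∉ S ∧ ∀ e ∈ M, v ∉ e}

/-- The multivariate matching polynomial of `G ∖ S`, evaluated at `z`. -/
noncomputable def matchingSum (G : SimpleGraph V) (S : Finset V) (z : V → ℂ) : ℂ :=
  ∑ M ∈ G.matchingsAvoiding S, (-1) ^ M.card * ∏ v ∈ uncovered S M, z v

variable {G : SimpleGraph V} {S : Finset V} {M : Finset (Sym2 V)} {z : V → ℂ}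

theorem mem_matchingsAvoiding :
    M ∈ G.matchingsAvoiding S ↔ G.IsEdgeMatching M ∧ ∀ e ∈ M, ∀ v ∈ e, v ∉ S := by
  simp [matchingsAvoiding]

theorem mem_uncovered {v : V} : v ∈ uncovered S M ↔ v ∉ S ∧ ∀ e ∈ M, v ∉ e := by
  simp [uncovered]

theorem matchingSum_univ : G.matchingSum Finset.univ z = 1 := by
  have h : G.matchingsAvoiding Finset.univ = {∅} := by
    ext M
    rw [mem_matchingsAvoiding, Finset.mem_singleton]
    constructor
    · rintro ⟨-, h⟩
      refine Finset.eq_empty_of_forall_notMem fun e he => ?_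
      induction e with
      | _ a b => exact h _ he a (Sym2.mem_mk_left a b) (Finset.mem_univ a)
    · rintro rfl
      simp [IsEdgeMatching]
  have h' : uncovered (Finset.univ : Finset V) ∅ = ∅ := by
    ext v; simp [mem_uncovered]
  simp [matchingSum, h, h']

theorem matchingSum_congr {y : V → ℂ} (h : ∀ v ∉ S, z v = y v) :
    G.matchingSum S z = G.matchingSum S y := by
  refine Finset.sum_congr rfl fun M _ => ?_
  congr 1
  exact Finset.prod_congr rfl fun v hv => h v (mem_uncovered.1 hv).1

-- Matchings that miss u give the first term. One that covers u is an edge uv together with a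
-- matching avoiding both ends, and the extra edge flips the sign.
open Classical in
theorem matchingSum_eq_sub (G : SimpleGraph V) (z : V → ℂ) {u : V} (hu : u ∉ S) :
    G.matchingSum S z = z u * G.matchingSum (insert u S) z -
      ∑ v with v ∉ insert u S ∧ G.Adj u v, G.matchingSum (insert v (insert u S)) z := by
  have key : ∀ M ∈ G.matchingsAvoiding S, (¬ ∀ e ∈ M, u ∉ e) →
      ∃ v, s(u, v) ∈ M := by
    intro M _ h
    push Not at h
    obtain ⟨e, he, hue⟩ := h
    obtain ⟨v, rfl⟩ := hue
    exact ⟨v, he⟩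
  rw [matchingSum, ← Finset.sum_filter_add_sum_filter_not _ (fun M => ∀ e ∈ M, u ∉ e),
    sub_eq_add_neg]
  congr 1
  · rw [matchingSum, Finset.mul_sum]
    refine Finset.sum_congr ?_ ?_
    · ext M
      simp only [Finset.mem_filter, mem_matchingsAvoiding, Finset.mem_insert, not_or]
      constructor
      · rintro ⟨⟨h1, h2⟩, h3⟩
        exact ⟨h1, fun e he v hv => ⟨fun h => h3 e he (h ▸ hv), h2 e he v hv⟩⟩
      · rintro ⟨h1, h2⟩
        exact ⟨⟨h1, fun e he v hv => (h2 e he v hv).2⟩, fun e he hv => (h2 e he u hv).1 rfl⟩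
    · intro M hM
      rw [mem_matchingsAvoiding] at hM
      have : uncovered S M = insert u (uncovered (insert u S) M) := by
        ext v
        simp only [mem_uncovered, Finset.mem_insert, not_or]
        constructor
        · rintro ⟨h1, h2⟩
          by_cases h : v = u
          · exact Or.inl h
          · exact Or.inr ⟨⟨h, h1⟩, h2⟩
        · rintro (rfl | ⟨⟨-, h1⟩, h2⟩)
          · exact ⟨hu, fun e he hv => hM.2 e he v hv (Finset.mem_insert_self _ _)⟩
          · exact ⟨h1, h2⟩
      rw [this, Finset.prod_insert (by simp [mem_uncovered])]
      ring
  · simp only [matchingSum]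
    rw [← Finset.sum_neg_distrib]
    simp only [← Finset.sum_neg_distrib]
    rw [Finset.sum_sigma']
    symm
    refine Finset.sum_bij (fun p _ => insert s(u, p.1) p.2) ?_ ?_ ?_ ?_
    · rintro ⟨v, N⟩ h
      simp only [Finset.mem_sigma, Finset.mem_filter, Finset.mem_univ, true_and,
        mem_matchingsAvoiding, Finset.mem_insert, not_or] at h ⊢
      obtain ⟨⟨⟨hvu, hvS⟩, huv⟩, ⟨hN1, hN2⟩, hN3⟩ := h
      refine ⟨⟨⟨?_, ?_⟩, ?_⟩, ?_⟩
      · intro e he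
        rcases Finset.mem_insert.1 he with rfl | he
        · exact huv
        · exact hN1 e he
      · intro e he f hf hef w hwe hwf
        rcases Finset.mem_insert.1 he with rfl | he <;> rcases Finset.mem_insert.1 hf with rfl | hf
        · exact hef rfl
        · have := hN3 f hf w hwf
          rcases Sym2.mem_iff.1 hwe with rfl | rfl
          · exact this.2.1 rfl
          · exact this.1 rfl
        · have := hN3 e he w hwe
          rcases Sym2.mem_iff.1 hwf with rfl | rfl
          · exact this.2.1 rfl
          · exact this.1 rfl
        · exact hN2 e he f hf hef w hwe hwf
      · rintro e (rfl | he) w hw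
        · rcases Sym2.mem_iff.1 hw with rfl | rfl
          · exact hu
          · exact hvS
        · exact (hN3 e he w hw).2.2
      · intro h
        exact h _ (Or.inl rfl) (Sym2.mem_mk_left u v)
    · rintro ⟨v, N⟩ h ⟨v', N'⟩ h' heq
      simp only [Finset.mem_sigma, Finset.mem_filter, Finset.mem_univ, true_and,
        mem_matchingsAvoiding, Finset.mem_insert, not_or] at h h' heq
      have hnot : ∀ w, s(u, w) ∉ N := fun w hw => (h.2.2 _ hw u (Sym2.mem_mk_left u w)).2.1 rfl
      have hnot' : ∀ w, s(u, w) ∉ N' := fun w hw =>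
        (h'.2.2 _ hw u (Sym2.mem_mk_left u w)).2.1 rfl
      have hv : v = v' := by
        have : s(u, v) ∈ insert s(u, v') N' := heq ▸ Finset.mem_insert_self _ _
        rcases Finset.mem_insert.1 this with h1 | h1
        · exact Sym2.congr_right.1 h1
        · exact absurd h1 (hnot' v)
      subst hv
      have : N = N' := by
        rw [← Finset.erase_insert (hnot v), heq, Finset.erase_insert (hnot' v)]
      rw [this]
    · intro M hM
      rw [Finset.mem_filter] at hM
      obtain ⟨v, hv⟩ := key M hM.1 hM.2
      obtain ⟨⟨hM1, hM2⟩, hM3⟩ := mem_matchingsAvoiding.1 hM.1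
      have huv : G.Adj u v := hM1 _ hv
      refine ⟨⟨v, M.erase s(u, v)⟩, ?_, Finset.insert_erase hv⟩
      simp only [Finset.mem_sigma, Finset.mem_filter, Finset.mem_univ, true_and,
        mem_matchingsAvoiding, Finset.mem_insert, not_or]
      refine ⟨⟨⟨huv.ne', hM3 _ hv v (Sym2.mem_mk_right u v)⟩, huv⟩,
        ⟨fun e he => hM1 e (Finset.mem_of_mem_erase he), fun e he f hf =>
          hM2 e (Finset.mem_of_mem_erase he) f (Finset.mem_of_mem_erase hf)⟩, ?_⟩
      intro e he w hw
      obtain ⟨hne, heM⟩ := Finset.mem_erase.1 he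
      refine ⟨?_, ?_, hM3 e heM w hw⟩
      · rintro rfl
        exact hM2 e heM _ hv hne w hw (Sym2.mem_mk_right u w)
      · rintro rfl
        exact hM2 e heM _ hv hne w hw (Sym2.mem_mk_left w v)
    · rintro ⟨v, N⟩ h
      simp only [Finset.mem_sigma, Finset.mem_filter, Finset.mem_univ, true_and,
        mem_matchingsAvoiding] at h
      have hnot : s(u, v) ∉ N := fun hw =>
        h.2.2 _ hw u (Sym2.mem_mk_left u v) (by simp)
      have : uncovered (insert v (insert u S)) N = uncovered S (insert s(u, v) N) := by
        ext w
        simp only [mem_uncovered, Finset.mem_insert, forall_eq_or_imp, Sym2.mem_iff]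
        tauto
      rw [Finset.card_insert_of_notMem hnot, this]
      ring

/-! ### Specialization to the one-variable matching polynomial -/

omit [Fintype V] in
open Classical in
theorem IsEdgeMatching.card_biUnion_toFinset (hM : G.IsEdgeMatching M) :
    (M.biUnion Sym2.toFinset).card = 2 * M.card := by
  rw [Finset.card_biUnion]
  · rw [Finset.sum_congr rfl fun e he =>
      Sym2.card_toFinset_of_not_isDiag e (G.not_isDiag_of_mem_edgeSet (hM.1 e he))]
    simp [mul_comm]
  · intro e he f hf hef
    rw [Function.onFun, Finset.disjoint_left]
    intro v
    simpa using hM.2 e he f hf hef v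

theorem card_uncovered (hM : M ∈ G.matchingsAvoiding S) :
    (uncovered S M).card = Fintype.card V - S.card - 2 * M.card := by
  classical
  obtain ⟨hM1, hM2⟩ := mem_matchingsAvoiding.1 hM
  have h : uncovered S M = Sᶜ \ M.biUnion Sym2.toFinset := by
    ext v; simp [mem_uncovered]
  rw [h, Finset.card_sdiff_of_subset, hM1.card_biUnion_toFinset, Finset.card_compl]
  intro v
  simp only [Finset.mem_biUnion, Sym2.mem_toFinset, Finset.mem_compl]
  rintro ⟨e, he, hv⟩
  exact hM2 e he v hv

theorem two_mul_card_le (hM : M ∈ G.matchingsAvoiding S) : 2 * M.card ≤ Fintype.card V := by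
  classical
  exact (mem_matchingsAvoiding.1 hM).1.card_biUnion_toFinset ▸ Finset.card_le_univ _

theorem aeval_matchingPolynomial_eq_matchingSum (G : SimpleGraph V) (t : ℂ) :
    aeval t G.matchingPolynomial = G.matchingSum ∅ fun _ => t := by
  classical
  have hmaps : ∀ M ∈ G.matchingsAvoiding ∅, M.card ∈ Finset.range (Nat.card V / 2 + 1) := by
    intro M hM
    have := two_mul_card_le hM
    rw [Finset.mem_range, Nat.card_eq_fintype_card]
    omega
  rw [matchingSum, ← Finset.sum_fiberwise_of_maps_to hmaps, matchingPolynomial, map_sum]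
  refine Finset.sum_congr rfl fun r _ => ?_
  have h : ∀ M ∈ (G.matchingsAvoiding ∅).filter (fun M => M.card = r),
      ((-1) ^ M.card * ∏ v ∈ uncovered ∅ M, t : ℂ) = (-1) ^ r * t ^ (Nat.card V - 2 * r) := by
    intro M hM
    obtain ⟨hM', rfl⟩ := Finset.mem_filter.1 hM
    rw [Finset.prod_const, card_uncovered hM', Nat.card_eq_fintype_card, Finset.card_empty,
      Nat.sub_zero]
  have hn : G.numMatchings r = ((G.matchingsAvoiding ∅).filter (fun M => M.card = r)).card := by
    rw [numMatchings, ← Set.ncard_coe_finset]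
    congr 1
    ext M
    simp [mem_matchingsAvoiding]
  rw [Finset.sum_congr rfl h, Finset.sum_const, hn, nsmul_eq_mul]
  simp
  ring

theorem matchingSum_eq_of_embedding {W : Type*} [Fintype W] {H : SimpleGraph W} (f : H ↪g G)
    (hf : ∀ v, v ∈ Set.range f ↔ v ∉ S) (t : ℂ) :
    H.matchingSum ∅ (fun _ => t) = G.matchingSum S fun _ => t := by
  classical
  have hcard : Fintype.card W = Fintype.card V - S.card := by
    rw [← Finset.card_compl, ← Finset.card_univ, ← Finset.card_map f.toEmbedding]
    congr 1
    ext v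
    simpa using hf v
  have hmem : ∀ (w : W) (e : Sym2 W), f w ∈ e.map f ↔ w ∈ e := fun w e =>
    Sym2.mem_map.trans ⟨by rintro ⟨a, ha, hw⟩; exact f.injective hw ▸ ha, fun h => ⟨w, h, rfl⟩⟩
  have hedge : ∀ e : Sym2 W, e.map f ∈ G.edgeSet ↔ e ∈ H.edgeSet := by
    intro e
    induction e with
    | _ a b => simp
  have hinj : Function.Injective (Sym2.map f) := Sym2.map.injective f.injective
  have hmatch : ∀ M, M.image (Sym2.map f) ∈ G.matchingsAvoiding S ↔
      M ∈ H.matchingsAvoiding ∅ := by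
    intro M
    simp only [mem_matchingsAvoiding, IsEdgeMatching, Finset.forall_mem_image, hedge,
      Finset.notMem_empty, not_false_eq_true, implies_true, and_true]
    constructor
    · rintro ⟨⟨h1, h2⟩, -⟩
      exact ⟨h1, fun e he g hg heg v hv hv' =>
        h2 he hg (hinj.ne heg) (f v) ((hmem v e).2 hv) ((hmem v g).2 hv')⟩
    · rintro ⟨h1, h2⟩
      refine ⟨⟨h1, fun e he g hg heg v hv hv' => ?_⟩, fun e he v hv => ?_⟩
      · obtain ⟨w, hw, rfl⟩ := Sym2.mem_map.1 hv
        exact h2 e he g hg (fun h => heg (h ▸ rfl)) w hw ((hmem w g).1 hv')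
      · obtain ⟨w, hw, rfl⟩ := Sym2.mem_map.1 hv
        exact (hf _).1 ⟨w, rfl⟩
  refine Finset.sum_bij (fun M _ => M.image (Sym2.map f)) (fun M hM => (hmatch M).2 hM)
    (fun M _ N _ h => Finset.image_injective hinj h) ?_ ?_
  · intro N hN
    obtain ⟨M, rfl⟩ : ∃ M : Finset (Sym2 W), M.image (Sym2.map f) = N := by
      have : (N : Set (Sym2 V)) ⊆ Set.range (Sym2.map f) := by
        intro e he
        have h3 := (mem_matchingsAvoiding.1 hN).2 e he
        induction e with
        | _ a b =>
          obtain ⟨a', rfl⟩ := (hf a).2 (h3 a (Sym2.mem_mk_left a b))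
          obtain ⟨b', rfl⟩ := (hf b).2 (h3 b (Sym2.mem_mk_right _ b))
          exact ⟨s(a', b'), by simp⟩
      obtain ⟨M, -, hM⟩ := Finset.subset_set_image_iff.1 (by rwa [Set.image_univ])
      exact ⟨M, hM⟩
    exact ⟨M, (hmatch M).1 hN, rfl⟩
  · intro M hM
    rw [Finset.card_image_of_injective _ hinj, Finset.prod_const, Finset.prod_const,
      card_uncovered hM, card_uncovered ((hmatch M).2 hM),
      Finset.card_image_of_injective _ hinj, Finset.card_empty, Nat.sub_zero, hcard]

theorem aeval_matchingPolynomial_removeVerts (G : SimpleGraph V) (S : Finset V) (t : ℂ) :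
    aeval t (G.removeVerts (S : Set V)).matchingPolynomial = G.matchingSum S fun _ => t := by
  classical
  rw [aeval_matchingPolynomial_eq_matchingSum]
  exact matchingSum_eq_of_embedding (Embedding.induce _) (by simp [Embedding.induce]) t

end
end SimpleGraph

/-! ### Stability in the upper half plane -/

namespace SimpleGraph

section
variable {V : Type*} [Fintype V] {S : Finset V} {z : V → ℂ}

-- By the recurrence, f_S / f_{S ∪ u} is z_u minus a sum of inverses of similar quotients with more
-- vertices deleted. Those quotients lie in the upper half plane by induction, so subtracting their
-- inverses can only raise the imaginary part.
open Classical in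
theorem matchingSum_ne_zero_and_im_le (G : SimpleGraph V) (hz : ∀ v, 0 < (z v).im)
    (S : Finset V) :
    G.matchingSum S z ≠ 0 ∧
      ∀ u ∉ S, (z u).im ≤ (G.matchingSum S z / G.matchingSum (insert u S) z).im := by
  induction h : Sᶜ.card using Nat.strong_induction_on generalizing S with
  | _ n ih =>
    have him : ∀ u ∉ S,
        (z u).im ≤ (G.matchingSum S z / G.matchingSum (insert u S) z).im := by
      intro u hu
      have hlt : (insert u S)ᶜ.card < n := by
        rw [← h]
        refine Finset.card_lt_card (Finset.compl_ssubset_compl.2 (Finset.ssubset_insert hu))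
      obtain ⟨h0, h1⟩ := ih _ hlt _ rfl
      rw [matchingSum_eq_sub G z hu, sub_div, mul_div_cancel_right₀ _ h0, Finset.sum_div,
        Complex.sub_im, Complex.im_sum]
      have : ∑ v with v ∉ insert u S ∧ G.Adj u v,
          (G.matchingSum (insert v (insert u S)) z / G.matchingSum (insert u S) z).im ≤ 0 := by
        refine Finset.sum_nonpos fun v hv => ?_
        have h2 := (hz v).le.trans (h1 v (Finset.mem_filter.1 hv).2.1)
        rw [← inv_div, Complex.inv_im]
        exact div_nonpos_of_nonpos_of_nonneg (neg_nonpos.2 h2) (Complex.normSq_nonneg _)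
      linarith
    refine ⟨?_, him⟩
    by_cases hS : S = Finset.univ
    · rw [hS, matchingSum_univ]; exact one_ne_zero
    · obtain ⟨u, hu⟩ : ∃ u, u ∉ S := by
        by_contra! hc
        exact hS (Finset.eq_univ_iff_forall.2 hc)
      intro h0
      have := him u hu
      rw [h0, zero_div, Complex.zero_im] at this
      exact (hz u).not_ge this

-- The imaginary-part bound makes each quotient in the recurrence at least ε in norm, so each
-- neighbour contributes at most 1/ε relative to f_{S ∪ u}.
open Classical in
theorem norm_matchingSum_le (G : SimpleGraph V) {ε : ℝ} (hε : 0 < ε)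
    (hz : ∀ v, ε ≤ (z v).im) {u : V} (hu : u ∉ S) :
    ‖G.matchingSum S z‖ ≤ (‖z u‖ + Fintype.card V / ε) * ‖G.matchingSum (insert u S) z‖ := by
  have hz' : ∀ v, 0 < (z v).im := fun v => hε.trans_le (hz v)
  obtain ⟨h0, h1⟩ := G.matchingSum_ne_zero_and_im_le hz' (insert u S)
  have hsum : ‖∑ v with v ∉ insert u S ∧ G.Adj u v,
      G.matchingSum (insert v (insert u S)) z‖ ≤
      Fintype.card V * (ε⁻¹ * ‖G.matchingSum (insert u S) z‖) := by
    refine (norm_sum_le_of_le _ (f := fun v => G.matchingSum (insert v (insert u S)) z)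
      (n := fun _ => ε⁻¹ * ‖G.matchingSum (insert u S) z‖) fun v hv => ?_).trans ?_
    · have h2 := (hz v).trans (h1 v (Finset.mem_filter.1 hv).2.1)
      have h3 : 0 < ‖G.matchingSum (insert v (insert u S)) z‖ :=
        norm_pos_iff.2 (G.matchingSum_ne_zero_and_im_le hz' _).1
      have h4 := h2.trans ((le_abs_self _).trans (Complex.abs_im_le_norm _))
      rw [norm_div, le_div_iff₀ h3] at h4
      rwa [inv_mul_eq_div, le_div_iff₀ hε, mul_comm]
    · rw [Finset.sum_const, nsmul_eq_mul]
      gcongr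
      exact Finset.card_le_univ _
  rw [matchingSum_eq_sub G z hu]
  calc _ ≤ _ := norm_sub_le _ _
    _ ≤ _ := add_le_add_right hsum _
    _ = _ := by rw [norm_mul]; ring

-- The polynomial is affine in each variable, and the slope in z_u is the deletion of u.
open Classical in
theorem matchingSum_update_add (G : SimpleGraph V) (z : V → ℂ) (x : ℂ) {u : V} (hu : u ∉ S) :
    G.matchingSum S (Function.update z u (z u + x)) =
      G.matchingSum S z + x * G.matchingSum (insert u S) z := by
  have h : ∀ T : Finset V, u ∈ T →
      G.matchingSum T (Function.update z u (z u + x)) = G.matchingSum T z := by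
    intro T hT
    refine matchingSum_congr fun v hv => ?_
    rw [Function.update_of_ne]
    rintro rfl
    exact hv hT
  rw [matchingSum_eq_sub G _ hu, matchingSum_eq_sub G z hu, h _ (Finset.mem_insert_self _ _),
    Finset.sum_congr rfl fun v _ => h (insert v (insert u S)) (by simp), Function.update_self]
  ring

end

end SimpleGraph

/-! ### Coefficient bounds for stable cubics -/

/-- If the zeros of a cubic `a + b x + c x² + d x³` avoid the open upper half plane, then `d` is
controlled by `a`, `b` and `c`. -/
theorem Complex.norm_sq_le_of_cubic_ne_zero {a b c d : ℂ} {B C : ℝ} (ha : a ≠ 0)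
    (h : ∀ x : ℂ, 0 < x.im → a + b * x + c * x ^ 2 + d * x ^ 3 ≠ 0)
    (hb : ‖b‖ ≤ B * ‖a‖) (hc : ‖c‖ ≤ C * ‖a‖) :
    ‖d‖ ^ 2 ≤ (3 * B ^ 2 + 2 * C) ^ 3 * ‖a‖ ^ 2 := by
  -- The reversed cubic, with leading coefficient a: its nonzero roots are the inverses of the zeros
  -- in question, so all its roots have nonnegative imaginary part, and d = 0 needs no separate
  -- case.
  let P : Cubic ℂ := ⟨a, b, c, d⟩
  have hP : P.a ≠ 0 := ha
  obtain ⟨x, y, z, h3⟩ := (Cubic.splits_iff_roots_eq_three (φ := RingHom.id ℂ) hP).1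
    (IsAlgClosed.splits _)
  have hroot : ∀ w ∈ (Cubic.map (RingHom.id ℂ) P).roots, 0 ≤ w.im := by
    intro w hw
    by_contra! hneg
    have hw0 : w ≠ 0 := by rintro rfl; simp at hneg
    have h0 : (Cubic.map (RingHom.id ℂ) P).toPoly ≠ 0 := Cubic.ne_zero_of_a_ne_zero ha
    have hw1 := (Cubic.mem_roots_iff h0 w).1 hw
    simp only [Cubic.map, P, RingHom.id_apply] at hw1
    refine h w⁻¹ ?_ ?_
    · rw [Complex.inv_im]
      exact div_pos (neg_pos.2 hneg) (Complex.normSq_pos.2 hw0)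
    · field_simp
      linear_combination hw1
  have hx := hroot x (by simp [h3])
  have hy := hroot y (by simp [h3])
  have hz := hroot z (by simp [h3])
  have eb : b = a * -(x + y + z) := by simpa [P] using Cubic.b_eq_three_roots hP h3
  have ec : c = a * (x * y + x * z + y * z) := by simpa [P] using Cubic.c_eq_three_roots hP h3
  have ed : d = a * -(x * y * z) := by simpa [P] using Cubic.d_eq_three_roots hP h3
  have hapos : 0 < ‖a‖ := norm_pos_iff.2 ha
  have hb' : ‖x + y + z‖ ≤ B := by
    rw [eb, norm_mul, norm_neg, mul_comm] at hb
    exact le_of_mul_le_mul_right hb hapos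
  have hc' : ‖x * y + x * z + y * z‖ ≤ C := by
    rw [ec, norm_mul, mul_comm] at hc
    exact le_of_mul_le_mul_right hc hapos
  have him : x.im + y.im + z.im ≤ B := by
    simpa using ((le_abs_self _).trans (Complex.abs_im_le_norm _)).trans hb'
  have hre : (x + y + z).re ^ 2 + (x + y + z).im ^ 2 ≤ B ^ 2 := by
    have := pow_le_pow_left₀ (norm_nonneg _) hb' 2
    rw [Complex.sq_norm, Complex.normSq_apply] at this
    linarith
  have hcre : -C ≤ (x * y + x * z + y * z).re :=
    (abs_le.1 ((Complex.abs_re_le_norm _).trans hc')).1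
  simp only [Complex.add_re, Complex.add_im, Complex.mul_re] at hre hcre
  -- The sum of squared norms is (∑ re)² + (∑ im)² - 2 Re e₂ - 4 ∑ im·im, and the last term helps
  -- because the imaginary parts are nonnegative. Without that sign the bound fails: t, ωt, ω²t with
  -- ω a primitive cube root of unity have e₁ = e₂ = 0.
  have hsum : ‖x‖ ^ 2 + ‖y‖ ^ 2 + ‖z‖ ^ 2 ≤ 3 * B ^ 2 + 2 * C := by
    simp only [Complex.sq_norm, Complex.normSq_apply]
    have h1 : (x.im + y.im + z.im) ^ 2 ≤ B ^ 2 := pow_le_pow_left₀ (by positivity) him 2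
    have h2 := mul_nonneg hx hy
    have h4 := mul_nonneg hx hz
    have h5 := mul_nonneg hy hz
    nlinarith
  have hx2 := sq_nonneg ‖x‖
  have hy2 := sq_nonneg ‖y‖
  have hz2 := sq_nonneg ‖z‖
  have hprod : ‖x‖ ^ 2 * ‖y‖ ^ 2 * ‖z‖ ^ 2 ≤ (3 * B ^ 2 + 2 * C) ^ 3 := by
    calc _ ≤ (3 * B ^ 2 + 2 * C) * (3 * B ^ 2 + 2 * C) * (3 * B ^ 2 + 2 * C) :=
          mul_le_mul (mul_le_mul (by linarith) (by linarith) hy2 (by linarith)) (by linarith) hz2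
            (mul_self_nonneg _)
      _ = _ := by ring
  calc ‖d‖ ^ 2 = ‖x‖ ^ 2 * ‖y‖ ^ 2 * ‖z‖ ^ 2 * ‖a‖ ^ 2 := by
        rw [ed, norm_mul, norm_neg, norm_mul, norm_mul]; ring
    _ ≤ _ := by gcongr

namespace SimpleGraph

section
variable {V : Type*} [Fintype V] {S : Finset V} {z : V → ℂ}

-- Adding x to the variables at u, v, w preserves stability when Im x > 0, which yields the cubic.
-- Its middle coefficients are sums of three terms, so 3B and 3C enter the cubic bound and produce
-- 27 and 6.
open Classical in
theorem norm_sq_matchingSum_insert_three_le (G : SimpleGraph V) (hz : ∀ v, 0 < (z v).im)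
    {u v w : V} (huv : u ≠ v) (huw : u ≠ w) (hvw : v ≠ w)
    (hu : u ∉ S) (hv : v ∉ S) (hw : w ∉ S) {B C : ℝ}
    (hB : ∀ a, a = u ∨ a = v ∨ a = w →
      ‖G.matchingSum (insert a S) z‖ ≤ B * ‖G.matchingSum S z‖)
    (hCuv : ‖G.matchingSum (insert u (insert v S)) z‖ ≤ C * ‖G.matchingSum S z‖)
    (hCuw : ‖G.matchingSum (insert u (insert w S)) z‖ ≤ C * ‖G.matchingSum S z‖)
    (hCvw : ‖G.matchingSum (insert v (insert w S)) z‖ ≤ C * ‖G.matchingSum S z‖) :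
    ‖G.matchingSum (insert u (insert v (insert w S))) z‖ ^ 2 ≤
      (27 * B ^ 2 + 6 * C) ^ 3 * ‖G.matchingSum S z‖ ^ 2 := by
  have hcub : ∀ x : ℂ, 0 < x.im → G.matchingSum S z +
      (G.matchingSum (insert u S) z + G.matchingSum (insert v S) z +
        G.matchingSum (insert w S) z) * x +
      (G.matchingSum (insert u (insert v S)) z + G.matchingSum (insert u (insert w S)) z +
        G.matchingSum (insert v (insert w S)) z) * x ^ 2 +
      G.matchingSum (insert u (insert v (insert w S))) z * x ^ 3 ≠ 0 := by
    intro x hx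
    let z₁ := Function.update z u (z u + x)
    let z₂ := Function.update z₁ v (z₁ v + x)
    let z₃ := Function.update z₂ w (z₂ w + x)
    have hup : ∀ (y : V → ℂ) (a : V), (∀ i, 0 < (y i).im) →
        ∀ i, 0 < (Function.update y a (y a + x) i).im := by
      intro y a hy i
      by_cases hi : i = a
      · subst hi
        rw [Function.update_self, Complex.add_im]
        exact add_pos (hy _) hx
      · rw [Function.update_of_ne hi]
        exact hy i
    have h := (G.matchingSum_ne_zero_and_im_le (hup z₂ w (hup z₁ v (hup z u hz))) S).1
    have e : G.matchingSum S z₃ = _ := G.matchingSum_update_add z₂ x hw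
    have e1 : G.matchingSum S z₂ = _ := G.matchingSum_update_add z₁ x hv
    have e2 : G.matchingSum (insert w S) z₂ = _ :=
      G.matchingSum_update_add z₁ x (u := v) (S := insert w S) (by simp [hv, hvw])
    have e3 : G.matchingSum S z₁ = _ := G.matchingSum_update_add z x hu
    have e4 : G.matchingSum (insert v S) z₁ = _ :=
      G.matchingSum_update_add z x (u := u) (S := insert v S) (by simp [hu, huv])
    have e5 : G.matchingSum (insert w S) z₁ = _ :=
      G.matchingSum_update_add z x (u := u) (S := insert w S) (by simp [hu, huw])
    have e6 : G.matchingSum (insert v (insert w S)) z₁ = _ :=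
      G.matchingSum_update_add z x (u := u) (S := insert v (insert w S)) (by simp [hu, huv, huw])
    rw [e1, e2, e3, e4, e5, e6] at e
    change G.matchingSum S z₃ ≠ 0 at h
    rw [e] at h
    convert h using 1
    ring
  have h := Complex.norm_sq_le_of_cubic_ne_zero (G.matchingSum_ne_zero_and_im_le hz S).1 hcub
    (B := 3 * B) (C := 3 * C)
    (norm_add₃_le.trans (by linarith [hB u (by simp), hB v (by simp), hB w (by simp)]))
    (norm_add₃_le.trans (by linarith))
  convert h using 2
  ring

end
end SimpleGraph

/-! ### Multiplicity as order of vanishing along θ + iε -/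

-- Split off (X - θ)^k: the cofactor tends to a nonzero limit, and |iε| = ε.
open Filter Topology Asymptotics in
theorem Polynomial.isTheta_aeval_vertical {p : ℝ[X]} (hp : p ≠ 0) (θ : ℝ) :
    (fun ε : ℝ => aeval (θ + ε * Complex.I : ℂ) p) =Θ[𝓝[>] 0]
      fun ε : ℝ => ε ^ p.rootMultiplicity θ := by
  obtain ⟨q, hq, hq'⟩ := exists_eq_pow_rootMultiplicity_mul_and_not_dvd p hp θ
  generalize p.rootMultiplicity θ = k at hq
  rw [hq]
  have h1 : (fun ε : ℝ => aeval (θ + ε * Complex.I : ℂ) q) =Θ[𝓝[>] 0] fun _ => (1 : ℝ) := by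
    have hcont : Continuous fun ε : ℝ => aeval (θ + ε * Complex.I : ℂ) q :=
      q.continuous_aeval.comp (by fun_prop)
    have hlim : Tendsto (fun ε : ℝ => aeval (θ + ε * Complex.I : ℂ) q) (𝓝[>] 0)
        (𝓝 (aeval (θ : ℂ) q)) := by
      simpa using (hcont.tendsto 0).mono_left nhdsWithin_le_nhds
    have hne : aeval (θ : ℂ) q ≠ 0 := by
      have : aeval (θ : ℂ) q = ((q.eval θ : ℝ) : ℂ) := by
        simpa using aeval_algebraMap_apply ℂ θ q
      rw [this, Complex.ofReal_ne_zero]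
      rwa [dvd_iff_isRoot] at hq'
    exact (isTheta_of_div_tendsto_nhds_ne_zero (f := fun _ : ℝ => (1 : ℂ)) (by simpa using hlim)
      hne).symm.trans (isTheta_const_const one_ne_zero one_ne_zero)
  have h2 : (fun ε : ℝ => (ε * Complex.I : ℂ)) =Θ[𝓝[>] 0] fun ε : ℝ => ε :=
    IsTheta.of_norm_eventuallyEq_norm (Eventually.of_forall fun ε => by simp)
  simpa using (h2.pow k).mul h1

open Filter Topology Asymptotics in
theorem le_of_isBigO_pow_nhdsGT_zero {m n : ℕ}
    (h : (fun ε : ℝ => ε ^ n) =O[𝓝[>] 0] fun ε : ℝ => ε ^ m) : m ≤ n := by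
  by_contra! hlt
  have h1 := h.trans_isLittleO ((isLittleO_pow_pow hlt).mono nhdsWithin_le_nhds)
  have h2 := isLittleO_irrefl' (l := 𝓝[>] (0 : ℝ)) (f' := fun ε : ℝ => ε ^ n)
  refine h2 (Eventually.frequently ?_) h1
  filter_upwards [self_mem_nhdsWithin] with ε hε
  exact (norm_pos_iff.2 (pow_pos hε n).ne').ne'

namespace SimpleGraph

section
variable {V : Type*} [Fintype V] {S : Finset V}

theorem matchingPolynomial_ne_zero (G : SimpleGraph V) : G.matchingPolynomial ≠ 0 := by
  intro h
  have h1 := aeval_matchingPolynomial_eq_matchingSum G Complex.I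
  rw [h, map_zero] at h1
  exact (G.matchingSum_ne_zero_and_im_le (z := fun _ => Complex.I) (by simp) ∅).1 h1.symm

open Filter Topology Asymptotics in
theorem isTheta_matchingSum (G : SimpleGraph V) (θ : ℝ) (S : Finset V) :
    (fun ε : ℝ => G.matchingSum S fun _ => (θ + ε * Complex.I : ℂ)) =Θ[𝓝[>] 0]
      fun ε : ℝ => ε ^ matchingMult θ (G.removeVerts (S : Set V)) := by
  classical
  simp only [← aeval_matchingPolynomial_removeVerts]
  exact isTheta_aeval_vertical (matchingPolynomial_ne_zero _) θ

-- The two graphs live on different vertex types; comparing orders of vanishing replaces an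
-- isomorphism argument.
open Filter Topology Asymptotics in
theorem matchingMult_removeVerts_empty (G : SimpleGraph V) (θ : ℝ) :
    matchingMult θ (G.removeVerts ((∅ : Finset V) : Set V)) = matchingMult θ G := by
  have h1 := isTheta_matchingSum G θ ∅
  simp only [← aeval_matchingPolynomial_eq_matchingSum] at h1
  have h2 := h1.symm.trans (isTheta_aeval_vertical (matchingPolynomial_ne_zero G) θ)
  exact le_antisymm (le_of_isBigO_pow_nhdsGT_zero h2.2) (le_of_isBigO_pow_nhdsGT_zero h2.1)

/-! ### Multiplicities under vertex deletion -/

-- For 0 < ε < 1, `norm_matchingSum_le` multiplied by ε says that ε · f_S = O(f_{S ∪ u}).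
open Filter Topology Asymptotics in
open Classical in
theorem matchingMult_insert_le (G : SimpleGraph V) (θ : ℝ) (S : Finset V) (u : V) :
    matchingMult θ (G.removeVerts (insert u S : Finset V)) ≤
      matchingMult θ (G.removeVerts (S : Set V)) + 1 := by
  by_cases hu : u ∈ S
  · rw [Finset.insert_eq_of_mem hu]; exact Nat.le_succ _
  refine le_of_isBigO_pow_nhdsGT_zero ?_
  refine IsBigO.trans_isTheta ?_ (isTheta_matchingSum G θ (insert u S))
  simp only [pow_succ']
  refine ((isTheta_refl (fun ε : ℝ => ε) _).mul
    (isTheta_norm_left.2 (isTheta_matchingSum G θ S)).symm).isBigO.trans ?_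
  refine IsBigO.of_bound (|θ| + 1 + Fintype.card V) ?_
  filter_upwards [Ioo_mem_nhdsGT (zero_lt_one (α := ℝ))] with ε ⟨hε, hε1⟩
  have h := norm_matchingSum_le (z := fun _ => (θ + ε * Complex.I : ℂ)) G hε (by simp) hu
  have ht : ‖(θ + ε * Complex.I : ℂ)‖ ≤ |θ| + 1 :=
    (norm_add_le _ _).trans (by simpa [abs_of_pos hε] using hε1.le)
  rw [norm_mul, norm_norm, Real.norm_of_nonneg hε.le]
  calc _ ≤ ε * ((|θ| + 1 + Fintype.card V / ε) *
        ‖G.matchingSum (insert u S) fun _ => (θ + ε * Complex.I : ℂ)‖) := by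
        gcongr
        exact h.trans (by gcongr)
    _ = (ε * (|θ| + 1) + Fintype.card V) *
        ‖G.matchingSum (insert u S) fun _ => (θ + ε * Complex.I : ℂ)‖ := by
        field_simp
    _ ≤ _ := by
        gcongr
        exact mul_le_of_le_one_left (by positivity) hε1.le

open Classical in
theorem matchingMult_union_le (G : SimpleGraph V) (θ : ℝ) (S T : Finset V) :
    matchingMult θ (G.removeVerts (T ∪ S : Finset V)) ≤
      matchingMult θ (G.removeVerts (S : Set V)) + T.card := by
  induction T using Finset.induction_on with
  | empty => rw [Finset.empty_union]; exact Nat.le_add_right _ _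
  | insert a T ha ih =>
    rw [Finset.insert_union, Finset.card_insert_of_notMem ha]
    exact (matchingMult_insert_le G θ _ a).trans (by omega)

open Filter Topology Asymptotics in
open Classical in
/-- Three vertices whose pairs are all `θ`-extreme form a `θ`-extreme set. -/
theorem add_three_le_matchingMult (G : SimpleGraph V) (θ : ℝ) {u v w : V}
    (huv : u ≠ v) (huw : u ≠ w) (hvw : v ≠ w) (hu : u ∉ S) (hv : v ∉ S) (hw : w ∉ S)
    (h1 : matchingMult θ (G.removeVerts (insert u (insert v S) : Finset V)) =
      matchingMult θ (G.removeVerts (S : Set V)) + 2)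
    (h2 : matchingMult θ (G.removeVerts (insert u (insert w S) : Finset V)) =
      matchingMult θ (G.removeVerts (S : Set V)) + 2)
    (h3 : matchingMult θ (G.removeVerts (insert v (insert w S) : Finset V)) =
      matchingMult θ (G.removeVerts (S : Set V)) + 2) :
    matchingMult θ (G.removeVerts (S : Set V)) + 3 ≤
      matchingMult θ (G.removeVerts (insert u (insert v (insert w S)) : Finset V)) := by
  -- Allowing every K' ≥ K lets the separate constants be replaced below by the common maxima B and
  -- C.
  have bound : ∀ (T : Finset V) (j : ℕ),
      matchingMult θ (G.removeVerts (S : Set V)) + j ≤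
        matchingMult θ (G.removeVerts (T : Set V)) →
      ∃ K, 0 ≤ K ∧ ∀ᶠ ε : ℝ in 𝓝[>] 0, ∀ K', K ≤ K' →
        ‖G.matchingSum T fun _ => (θ + ε * Complex.I : ℂ)‖ ≤
          K' * ε ^ j * ‖G.matchingSum S fun _ => (θ + ε * Complex.I : ℂ)‖ := by
    intro T j hT
    have hb : (fun ε : ℝ => G.matchingSum T fun _ => (θ + ε * Complex.I : ℂ)) =O[𝓝[>] 0]
        fun ε : ℝ => ε ^ j * ‖G.matchingSum S fun _ => (θ + ε * Complex.I : ℂ)‖ := by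
      refine (isTheta_matchingSum G θ T).isBigO.trans (IsBigO.trans ?_
        ((isTheta_refl (fun ε : ℝ => ε ^ j) _).mul
          (isTheta_norm_left.2 (isTheta_matchingSum G θ S))).symm.isBigO)
      simp only [← pow_add]
      rw [add_comm] at hT
      rcases hT.eq_or_lt with h | h
      · rw [h]; exact isBigO_refl _ _
      · exact ((isLittleO_pow_pow h).mono nhdsWithin_le_nhds).isBigO
    obtain ⟨K, hK, hb⟩ := hb.exists_nonneg
    refine ⟨K, hK, ?_⟩
    filter_upwards [hb.bound, self_mem_nhdsWithin] with ε h hε K' hK'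
    have hε : (0 : ℝ) < ε := hε
    rw [norm_mul, norm_norm, Real.norm_of_nonneg (by positivity)] at h
    rw [mul_assoc]
    exact h.trans (by gcongr)
  have single : ∀ a b, matchingMult θ (G.removeVerts (insert a (insert b S) : Finset V)) =
      matchingMult θ (G.removeVerts (S : Set V)) + 2 →
      matchingMult θ (G.removeVerts (S : Set V)) + 1 ≤
        matchingMult θ (G.removeVerts (insert b S : Finset V)) := by
    intro a b h
    have := matchingMult_insert_le G θ (insert b S) a
    omega
  obtain ⟨Bu, hBu0, hBu⟩ := bound (insert u S) 1
    (single v u (by rw [Finset.insert_comm]; exact h1))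
  obtain ⟨Bv, -, hBv⟩ := bound (insert v S) 1 (single u v h1)
  obtain ⟨Bw, -, hBw⟩ := bound (insert w S) 1 (single u w h2)
  obtain ⟨C₁, -, hC₁⟩ := bound _ 2 h1.ge
  obtain ⟨C₂, -, hC₂⟩ := bound _ 2 h2.ge
  obtain ⟨C₃, -, hC₃⟩ := bound _ 2 h3.ge
  let B := max Bu (max Bv Bw)
  let C := max C₁ (max C₂ C₃)
  -- With Bε and Cε² as bounds, (27(Bε)² + 6Cε²)³ is a constant times ε⁶; comparing exponents of the
  -- squares then gives the gain of 3.
  have hsq : (fun ε : ℝ => (G.matchingSum (insert u (insert v (insert w S)))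
      fun _ => (θ + ε * Complex.I : ℂ)) ^ 2) =O[𝓝[>] 0]
      fun ε : ℝ => ε ^ 6 * ‖G.matchingSum S fun _ => (θ + ε * Complex.I : ℂ)‖ ^ 2 := by
    refine IsBigO.of_bound ((27 * B ^ 2 + 6 * C) ^ 3) ?_
    filter_upwards [hBu, hBv, hBw, hC₁, hC₂, hC₃, self_mem_nhdsWithin]
      with ε hu' hv' hw' h1' h2' h3' hε
    have hε : (0 : ℝ) < ε := hε
    have := norm_sq_matchingSum_insert_three_le (z := fun _ => (θ + ε * Complex.I : ℂ)) G
      (fun _ => by simpa using hε) huv huw hvw hu hv hw (B := B * ε ^ 1) (C := C * ε ^ 2)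
      (by
        rintro a (rfl | rfl | rfl)
        · exact hu' _ (le_max_left _ _)
        · exact hv' _ ((le_max_left _ _).trans (le_max_right _ _))
        · exact hw' _ ((le_max_right _ _).trans (le_max_right _ _)))
      (h1' _ (le_max_left _ _)) (h2' _ ((le_max_left _ _).trans (le_max_right _ _)))
      (h3' _ ((le_max_right _ _).trans (le_max_right _ _)))
    rw [norm_pow, norm_mul, norm_pow, norm_pow, norm_norm, Real.norm_of_nonneg hε.le]
    refine this.trans_eq ?_
    ring
  have hfin := ((isTheta_matchingSum G θ (insert u (insert v (insert w S)))).pow 2).symm.isBigO.trans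
    (hsq.trans ((isTheta_refl (fun ε : ℝ => ε ^ 6) _).mul
      ((isTheta_norm_left.2 (isTheta_matchingSum G θ S)).pow 2)).isBigO)
  simp only [← pow_mul, ← pow_add] at hfin
  have := le_of_isBigO_pow_nhdsGT_zero hfin
  omega

-- Delete one vertex w of T and apply the induction hypothesis to the rest: the multiplicity rises
-- by 1 for w and, by the three-vertex case, by 3 for u, v, w, so each pair u, v still gains 2
-- relative to G ∖ (S ∪ w).
open Classical in
theorem matchingMult_union_of_pairs (G : SimpleGraph V) (θ : ℝ) (T S : Finset V)
    (hT : 2 ≤ T.card) (hd : Disjoint T S)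
    (h : ∀ u ∈ T, ∀ v ∈ T, u ≠ v →
      matchingMult θ (G.removeVerts (insert u (insert v S) : Finset V)) =
        matchingMult θ (G.removeVerts (S : Set V)) + 2) :
    matchingMult θ (G.removeVerts (T ∪ S : Finset V)) =
      matchingMult θ (G.removeVerts (S : Set V)) + T.card := by
  induction T using Finset.induction_on generalizing S with
  | empty => simp at hT
  | insert w T hw ih =>
    rw [Finset.card_insert_of_notMem hw] at hT ⊢
    rw [Finset.disjoint_insert_left] at hd
    have hne : ∀ v ∈ T, v ≠ w := fun v hv hvw => hw (hvw ▸ hv)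
    rcases (show T.card = 1 ∨ 2 ≤ T.card by omega) with h1 | h2
    · obtain ⟨v, rfl⟩ := Finset.card_eq_one.1 h1
      rw [h1, Finset.insert_union, Finset.singleton_union]
      exact h w (by simp) v (by simp) (hne v (by simp)).symm
    · have hS : ∀ v ∈ T, v ∉ S := fun v hv => Finset.disjoint_left.1 hd.2 hv
      -- A pair gains 2 and each single deletion gains at most 1, so both gain exactly 1.
      have hw1 : matchingMult θ (G.removeVerts (insert w S : Finset V)) =
          matchingMult θ (G.removeVerts (S : Set V)) + 1 := by
        obtain ⟨v, hv⟩ := Finset.card_pos.1 (by omega : 0 < T.card)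
        have e1 := h v (by simp [hv]) w (by simp) (hne v hv)
        have e2 := matchingMult_insert_le G θ (insert w S) v
        have e3 := matchingMult_insert_le G θ S w
        omega
      have := ih (insert w S) h2 (Finset.disjoint_insert_right.2 ⟨hw, hd.2⟩) ?_
      · rw [Finset.insert_union, ← Finset.union_insert, this, hw1]
        omega
      · intro u hu v hv huv
        have e1 := h u (by simp [hu]) v (by simp [hv]) huv
        have e2 := h u (by simp [hu]) w (by simp) (hne u hu)
        have e3 := h v (by simp [hv]) w (by simp) (hne v hv)
        have e4 := add_three_le_matchingMult G θ huv (hne u hu) (hne v hv) (hS u hu) (hS v hv)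
          hd.1 e1 e2 e3
        have e5 := matchingMult_insert_le G θ (insert v (insert w S)) u
        rw [hw1]
        omega

end
end SimpleGraph

theorem mainTheorem2 {V : Type*} [Finite V] (G : SimpleGraph V) (θ : ℝ) (S : Set V)
    (hS : 1 < S.ncard) : G.IsExtreme θ S ↔ G.IsNice θ S := by
  classical
  have := Fintype.ofFinite V
  obtain ⟨T, rfl⟩ : ∃ T : Finset V, (T : Set V) = S := ⟨S.toFinset, by simp⟩
  have hpair : ∀ u v : V, SimpleGraph.matchingMult θ (G.removeVerts {u, v}) =
      SimpleGraph.matchingMult θ (G.removeVerts ({u, v} : Finset V)) := fun u v => by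
    rw [Finset.coe_pair]
  rw [Set.ncard_coe_finset] at hS
  simp only [SimpleGraph.IsExtreme, SimpleGraph.IsNice, hS, true_and, hpair, Finset.mem_coe,
    Set.ncard_coe_finset, ← G.matchingMult_removeVerts_empty θ]
  constructor
  · intro h u hu v hv huv
    -- Deleting the pair gains at most 2 and deleting the rest of T at most |T| - 2. Since the total
    -- gain is |T|, both bounds are equalities.
    have h1 := G.matchingMult_union_le θ {u, v} (T \ {u, v})
    have h2 := G.matchingMult_union_le θ ∅ {u, v}
    have hsub : ({u, v} : Finset V) ⊆ T := by
      simp [Finset.insert_subset_iff, hu, hv]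
    have hc := Finset.card_sdiff_add_card_eq_card hsub
    rw [Finset.sdiff_union_of_subset hsub] at h1
    rw [Finset.union_empty] at h2
    rw [Finset.card_pair huv] at h2 hc
    omega
  · intro h
    have := G.matchingMult_union_of_pairs θ T ∅ hS (Finset.disjoint_empty_right _) h
    rwa [Finset.union_empty] at this
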